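/- Let $A_K \in \mathbb{R}^{n_x \times n_x}$ and consider the system $x(k+1) = A_K x(k) + w(k)$, where the disturbances $w(k)$, $k \ge 0$, are i.i.d. random vectors in $\mathbb{R}^{n_x}$ with distribution $\mathcal{D}$. For $p \in \mathbb{R}$, a set $\mathcal{R} \subseteq \mathbb{R}^{n_x}$ is called an $n$-step probabilistic reachable set ($n$-step PRS) of level $p$ if $x(0)=0$ implies $\Pr(x(n)\in\mathcal{R}) \ge p$, and a probabilistic reachable set (PRS) of level $p$ if it is an $n$-step PRS of level $p$ for every $n \ge 0$. The distribution $\mathcal{D}$ is called central convex unimodal if it lies in the closure, with respect to weak convergence, of the convex hull of the uniform distributions on symmetric ($K=-K$) compact convex bodies $K \subset \mathbb{R}^{n_x}$ (with nonempty interior). All sets $\mathcal{R}$, $\mathcal{R}^n$ below are Borel. Suppose that $\mathcal{D}$ is central convex unimodal. Then for every level $p$: (i) For every $n \ge 1$, every convex symmetric $n$-step PRS of level $p$ is also an $(n-1)$-step PRS of level $p$. (ii) The convex symmetric $n$-step PRS are nested: for every $n \ge 0$, every convex symmetric $n$-step PRS of level $p$ is an $i$-step PRS of level $p$ for all $0 \le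 i \le n$. (iii) PRS are obtained as limits: if $(\mathcal{R}^n)_{n\ge1}$ is a sequence of sets such that each $\mathcal{R}^n$ is a convex symmetric $n$-step PRS of level $p$, then the upper limit $\limsup_{n\to\infty}\mathcal{R}^n = \bigcap_{N}\bigcup_{n\ge N}\mathcal{R}^n$ is a PRS of level $p$. In particular, whenever the set-theoretic limit $\lim_{n\to\infty} \mathcal{R}^n$ exists (lower and upper limit coincide), it is a PRS of level $p$. If $\mathcal{R}^n \subseteq \mathcal{R}^{n+1}$ for all $n\ge 1$, then the limit exists and equals $\bigcup_{n\ge1}\mathcal{R}^n$, which is therefore a PRS of level $p$. -/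

import Mathlib

open MeasureTheory ProbabilityTheory Filter
open scoped NNReal

/-- A subset of a vector space is (centrally) symmetric if it contains `-x` with every `x`. -/
def IsSymmetricSet {E : Type*} [Neg E] (R : Set E) : Prop :=
  ∀ x ∈ R, -x ∈ R

/-- The uniform distributions on the symmetric compact convex bodies of `ℝⁿ`, a body being a set
with nonempty interior: the normalized restrictions of Lebesgue measure to such bodies. -/
def symmetricBodyUniforms (n : ℕ) : Set (FiniteMeasure (EuclideanSpace ℝ (Fin n))) :=
  {ν | ∃ K : Set (EuclideanSpace ℝ (Fin n)), IsCompact K ∧ Convex ℝ K ∧ (interior K).Nonempty ∧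
    IsSymmetricSet K ∧ (ν : Measure (EuclideanSpace ℝ (Fin n))) = cond volume K}

/-- A probability distribution on `ℝⁿ` is central convex unimodal if it lies in the closure, for
weak convergence of probability measures, of the convex hull of the uniform distributions on
symmetric compact convex bodies. -/
def IsCentralConvexUnimodal {n : ℕ} (D : ProbabilityMeasure (EuclideanSpace ℝ (Fin n))) : Prop :=
  D ∈ closure {μ : ProbabilityMeasure (EuclideanSpace ℝ (Fin n)) |
    μ.toFiniteMeasure ∈ convexHull ℝ≥0 (symmetricBodyUniforms n)}

/-- The state `x(k)` of the system `x(k+1) = A x(k) + w(k)` started at `x(0) = 0`. -/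
noncomputable def stateFromZero {n : ℕ} {Ω : Type*} (A : Matrix (Fin n) (Fin n) ℝ)
    (w : ℕ → Ω → EuclideanSpace ℝ (Fin n)) : ℕ → Ω → EuclideanSpace ℝ (Fin n)
  | 0 => fun _ => 0
  | k + 1 => fun ω => Matrix.toEuclideanLin A (stateFromZero A w k ω) + w k ω

/-- `R` is a probabilistic `k`-step reachable set of probability level `p` for the system
`x(k+1) = A x(k) + w(k)`: if `x(0) = 0` then `Pr(x(k) ∈ R) ≥ p`. -/
def IsStepPRS {n : ℕ} {Ω : Type*} [MeasurableSpace Ω] (P : Measure Ω)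
    (A : Matrix (Fin n) (Fin n) ℝ) (w : ℕ → Ω → EuclideanSpace ℝ (Fin n))
    (k : ℕ) (R : Set (EuclideanSpace ℝ (Fin n))) (p : ℝ) : Prop :=
  p ≤ P.real {ω | stateFromZero A w k ω ∈ R}

/-- `R` is a probabilistic reachable set (infinite horizon) of probability level `p` for the
system `x(k+1) = A x(k) + w(k)`: if `x(0) = 0` then `Pr(x(k) ∈ R) ≥ p` for all `k ≥ 0`. -/
def IsPRS {n : ℕ} {Ω : Type*} [MeasurableSpace Ω] (P : Measure Ω)
    (A : Matrix (Fin n) (Fin n) ℝ) (w : ℕ → Ω → EuclideanSpace ℝ (Fin n))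
    (R : Set (EuclideanSpace ℝ (Fin n))) (p : ℝ) : Prop :=
  ∀ k : ℕ, IsStepPRS P A w k R p

/-- The sequence of sets `S` converges to `L` in the set-theoretic sense: the lower limit (points
in all but finitely many `S k`) and the upper limit (points in infinitely many `S k`) are `L`. -/
def IsSetLimit {E : Type*} (S : ℕ → Set E) (L : Set E) : Prop :=
  liminf S atTop = L ∧ limsup S atTop = L

open scoped ENNReal Topology BoundedContinuousFunction

/-! Reversing the order of the i.i.d. disturbances shows that x(k+1) has the law of x(k) plus an
independent vector (`exists_stateLaw_succ_eq_conv`). By Anderson's inequality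
(`measureReal_preimage_add_le`), no translate of a symmetric convex set has larger measure under the
law of x(k) than the set itself; averaging over the added vector, Pr(x(k) ∈ R) is nonincreasing in k
(`antitone_stateLaw_real`). This is the nestedness. For the limit, fix k: all sets with index n ≥ k
have level p under the law of x(k), and a finite measure gives their upper limit at least p
(`le_measureReal_limsup`).

Anderson's inequality has to hold for the law of x(k), not only for that of w. Uniform laws on
bodies are not stable under convolution or singular matrices, so they are embedded in the symmetric
measures satisfying Prékopa–Leindler, which are stable under both. Weak limits of mixtures are
treated by duality: a linear inequality between integrals of bounded continuous functions that holds
for these measures passes to the closed convex hull. -/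

/-! ### Brunn–Minkowski and Prékopa–Leindler on the line. -/

/-- The one-dimensional Brunn–Minkowski inequality for compact sets. -/
theorem volume_add_volume_le_of_isCompact {A B C : Set ℝ} (hA : IsCompact A) (hB : IsCompact B)
    (hA0 : A.Nonempty) (hB0 : B.Nonempty) (hC : ∀ x ∈ A, ∀ y ∈ B, x + y ∈ C) :
    volume A + volume B ≤ volume C := by
  -- With a = max A and b = min B, the translates b + A and a + B both lie in C and meet only at a +
  -- b.
  obtain ⟨a, haA, ha⟩ := hA.exists_isGreatest hA0
  obtain ⟨b, hbB, hb⟩ := hB.exists_isLeast hB0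
  have h1 : volume ((fun x => b + x) '' A) = volume A := by
    rw [Set.image_add_left, measure_preimage_add]
  have h2 : volume ((fun x => a + x) '' B) = volume B := by
    rw [Set.image_add_left, measure_preimage_add]
  have hd : AEDisjoint volume ((fun x => b + x) '' A) ((fun x => a + x) '' B) := by
    refine measure_mono_null (t := {a + b}) ?_ (by simp)
    rintro _ ⟨⟨x, hx, rfl⟩, ⟨y, hy, hxy⟩⟩
    have := ha hx
    have := hb hy
    simp only [Set.mem_singleton_iff] at *
    linarith
  rw [← h1, ← h2, ← measure_union₀ ?_ hd]
  · refine measure_mono (Set.union_subset ?_ ?_)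
    · rintro _ ⟨x, hx, rfl⟩
      simpa [add_comm] using hC x hx b hbB
    · rintro _ ⟨y, hy, rfl⟩
      exact hC a haA y hy
  · exact (hB.image (by fun_prop)).measurableSet.nullMeasurableSet

/-- The one-dimensional Brunn–Minkowski inequality. -/
theorem volume_add_volume_le {A B C : Set ℝ} (hA : MeasurableSet A) (hB : MeasurableSet B)
    (hA0 : A.Nonempty) (hB0 : B.Nonempty) (hC : ∀ x ∈ A, ∀ y ∈ B, x + y ∈ C) :
    volume A + volume B ≤ volume C := by
  obtain ⟨a, ha⟩ := hA0
  obtain ⟨b, hb⟩ := hB0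
  have key : ∀ K ⊆ A, IsCompact K → ∀ L ⊆ B, IsCompact L → volume K + volume L ≤ volume C := by
    intro K hKA hK L hLB hL
    -- The points a and b are inserted to keep the compact sets nonempty.
    refine le_trans (add_le_add (measure_mono (Set.subset_insert a K))
      (measure_mono (Set.subset_insert b L))) ?_
    refine volume_add_volume_le_of_isCompact (hK.insert a) (hL.insert b) (by simp) (by simp) ?_
    rintro x hx y hy
    exact hC x (Set.insert_subset ha hKA hx) y (Set.insert_subset hb hLB hy)
  rw [hA.measure_eq_iSup_isCompact, hB.measure_eq_iSup_isCompact]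
  simp_rw [iSup_and']
  exact ENNReal.biSup_add_biSup_le' ⟨∅, by simp⟩ ⟨∅, by simp⟩
    fun K hK L hL => key K hK.1 hK.2 L hL.1 hL.2

theorem volume_add_volume_le_two_mul {A B C : Set ℝ} (hA : MeasurableSet A) (hB : MeasurableSet B)
    (hA0 : A.Nonempty) (hB0 : B.Nonempty) (hC : ∀ x ∈ A, ∀ y ∈ B, (2⁻¹ : ℝ) • (x + y) ∈ C) :
    volume A + volume B ≤ 2 * volume C := by
  have := volume_add_volume_le (C := (fun x => (2⁻¹ : ℝ) * x) ⁻¹' C) hA hB hA0 hB0 hC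
  rw [Real.volume_preimage_mul_left (by norm_num)] at this
  simpa using this

theorem lintegral_eq_lintegral_Ioo_meas_lt {f : ℝ → ℝ} (hf : Measurable f) (hf0 : ∀ x, 0 ≤ f x)
    (hf1 : ∀ x, f x ≤ 1) :
    ∫⁻ x, ENNReal.ofReal (f x) = ∫⁻ t in Set.Ioo (0 : ℝ) 1, volume {x | t < f x} := by
  rw [lintegral_eq_lintegral_meas_lt _ (ae_of_all _ hf0) hf.aemeasurable,
    ← Set.Ioo_union_Ici_eq_Ioi zero_lt_one, lintegral_union measurableSet_Ici]
  · rw [setLIntegral_congr_fun (g := fun _ => 0) measurableSet_Ici]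
    · simp
    · intro t ht
      have : {x | t < f x} = ∅ := by
        ext x
        simpa using (hf1 x).trans ht
      simp [this]
  · exact Set.disjoint_left.2 fun x hx hx' => not_le.2 hx.2 hx'

/-- The one-dimensional Prékopa–Leindler inequality, in additive form, for functions with
supremum one. -/
theorem lintegral_add_lintegral_le_of_sup_eq_one {f g h : ℝ → ℝ} (hf : Measurable f)
    (hg : Measurable g) (hh : Measurable h) (hf0 : ∀ x, 0 ≤ f x) (hg0 : ∀ x, 0 ≤ g x)
    (hh0 : ∀ x, 0 ≤ h x) (hf1 : ∀ x, f x ≤ 1) (hg1 : ∀ x, g x ≤ 1) (hh1 : ∀ x, h x ≤ 1)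
    (hfs : ∀ t < 1, ∃ x, t < f x) (hgs : ∀ t < 1, ∃ x, t < g x)
    (H : ∀ x y, f x * g y ≤ h ((2⁻¹ : ℝ) • (x + y)) ^ 2) :
    (∫⁻ x, ENNReal.ofReal (f x)) + ∫⁻ x, ENNReal.ofReal (g x) ≤
      2 * ∫⁻ x, ENNReal.ofReal (h x) := by
  rw [lintegral_eq_lintegral_Ioo_meas_lt hf hf0 hf1, lintegral_eq_lintegral_Ioo_meas_lt hg hg0 hg1,
    lintegral_eq_lintegral_Ioo_meas_lt hh hh0 hh1, ← lintegral_const_mul', ← lintegral_add_left']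
  · refine setLIntegral_mono' measurableSet_Ioo fun t ht => ?_
    refine volume_add_volume_le_two_mul (measurableSet_lt measurable_const hf)
      (measurableSet_lt measurable_const hg) (hfs t ht.2) (hgs t ht.2) fun x hx y hy => ?_
    have h1 : t * t < f x * g y := mul_lt_mul'' hx hy ht.1.le ht.1.le
    exact lt_of_pow_lt_pow_left₀ 2 (hh0 _) (by nlinarith [H x y])
  · refine Measurable.aemeasurable (Antitone.measurable ?_)
    exact fun s t hst => measure_mono fun x hx => lt_of_le_of_lt hst hx
  · simp

theorem ENNReal.four_mul_mul_le_sq_add (a b : ℝ≥0∞) : 4 * (a * b) ≤ (a + b) ^ 2 := by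
  wlog hab : a ≤ b generalizing a b
  · simpa [mul_comm, add_comm] using this b a (le_of_not_ge hab)
  obtain ⟨c, rfl⟩ := exists_add_of_le hab
  calc 4 * (a * (a + c)) ≤ 4 * (a * (a + c)) + c ^ 2 := le_self_add
    _ = _ := by ring

/-- A measure on a real vector space is midpoint log-concave if it satisfies the Prékopa–Leindler
inequality with parameter `1 / 2`. -/
def IsMidpointLogConcave {E : Type*} [AddCommGroup E] [Module ℝ E] [MeasurableSpace E]
    (μ : Measure E) : Prop :=
  ∀ f g h : E → ℝ≥0∞, Measurable f → Measurable g → Measurable h →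
    (∀ x y, f x * g y ≤ h ((2⁻¹ : ℝ) • (x + y)) ^ 2) →
    (∫⁻ x, f x ∂μ) * ∫⁻ x, g x ∂μ ≤ (∫⁻ x, h x ∂μ) ^ 2

theorem lintegral_mul_lintegral_le_of_iSup_eq_one {f g h : ℝ → ℝ≥0∞} (hf : Measurable f)
    (hg : Measurable g) (hh : Measurable h) (hfs : ⨆ x, f x = 1) (hgs : ⨆ x, g x = 1)
    (H : ∀ x y, f x * g y ≤ h ((2⁻¹ : ℝ) • (x + y)) ^ 2) :
    (∫⁻ x, f x) * ∫⁻ x, g x ≤ (∫⁻ x, h x) ^ 2 := by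
  have hf1 : ∀ x, f x ≤ 1 := fun x => hfs ▸ le_iSup f x
  have hg1 : ∀ x, g x ≤ 1 := fun x => hgs ▸ le_iSup g x
  have toReal_le : ∀ {a : ℝ≥0∞}, a ≤ 1 → a.toReal ≤ 1 := fun ha =>
    ENNReal.toReal_le_of_le_ofReal zero_le_one (by simpa using ha)
  have sup : ∀ {u : ℝ → ℝ≥0∞}, (∀ x, u x ≤ 1) → ⨆ x, u x = 1 → ∀ t < 1, ∃ x, t < (u x).toReal := by
    intro u hu1 hus t ht
    have : ENNReal.ofReal t < ⨆ x, u x := by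
      rw [hus, ← ENNReal.ofReal_one]
      exact (ENNReal.ofReal_lt_ofReal_iff zero_lt_one).2 ht
    obtain ⟨x, hx⟩ := lt_iSup_iff.1 this
    exact ⟨x, by
      rcases lt_or_ge t 0 with h0 | h0
      · exact h0.trans_le ENNReal.toReal_nonneg
      · exact (ENNReal.ofReal_lt_iff_lt_toReal h0 ((hu1 x).trans_lt ENNReal.one_lt_top).ne).1 hx⟩
  -- Since f and g are at most 1, truncating h at 1 preserves the hypothesis. The additive bound
  -- then becomes multiplicative by 4ab ≤ (a + b)².
  set k : ℝ → ℝ≥0∞ := fun x => min (h x) 1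
  have hk1 : ∀ x, k x ≤ 1 := fun x => min_le_right _ _
  have key := lintegral_add_lintegral_le_of_sup_eq_one hf.ennreal_toReal hg.ennreal_toReal
    (hh.min measurable_const).ennreal_toReal (h := fun x => (k x).toReal)
    (fun _ => ENNReal.toReal_nonneg)
    (fun _ => ENNReal.toReal_nonneg) (fun _ => ENNReal.toReal_nonneg) (fun x => toReal_le (hf1 x))
    (fun x => toReal_le (hg1 x)) (fun x => toReal_le (hk1 x)) (sup hf1 hfs) (sup hg1 hgs) ?_
  · have ofr : ∀ {u : ℝ → ℝ≥0∞}, (∀ x, u x ≤ 1) → ∀ x, ENNReal.ofReal (u x).toReal = u x :=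
      fun hu x => ENNReal.ofReal_toReal ((hu x).trans_lt ENNReal.one_lt_top).ne
    simp_rw [ofr hf1, ofr hg1, ofr hk1] at key
    have hkh : ∫⁻ x, k x ≤ ∫⁻ x, h x := lintegral_mono fun x => min_le_left _ _
    have h4 := (ENNReal.four_mul_mul_le_sq_add _ _).trans
      (pow_le_pow_left' (key.trans (mul_le_mul_right hkh 2)) 2)
    rw [mul_pow, show (2 : ℝ≥0∞) ^ 2 = 4 by norm_num] at h4
    exact (ENNReal.mul_le_mul_iff_right (by norm_num) (by norm_num)).1 h4
  · intro x y
    rw [← ENNReal.toReal_mul, ← ENNReal.toReal_pow]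
    refine ENNReal.toReal_mono (by
      exact (ENNReal.pow_lt_top ((hk1 _).trans_lt ENNReal.one_lt_top)).ne) ?_
    rcases min_cases (h ((2⁻¹ : ℝ) • (x + y))) 1 with h' | h'
    · simp only [k, h'.1]
      exact H x y
    · simp only [k, h'.1, one_pow]
      exact mul_le_one' (hf1 x) (hg1 y)

theorem lintegral_mul_lintegral_le_of_iSup_ne_top {f g h : ℝ → ℝ≥0∞} (hf : Measurable f)
    (hg : Measurable g) (hh : Measurable h) (hfs : ⨆ x, f x ≠ ∞) (hgs : ⨆ x, g x ≠ ∞)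
    (H : ∀ x y, f x * g y ≤ h ((2⁻¹ : ℝ) • (x + y)) ^ 2) :
    (∫⁻ x, f x) * ∫⁻ x, g x ≤ (∫⁻ x, h x) ^ 2 := by
  set a := ⨆ x, f x with ha
  set b := ⨆ x, g x with hb
  rcases eq_or_ne a 0 with ha0 | ha0
  · have : f = 0 := by ext x; simpa using (ENNReal.iSup_eq_zero.1 ha0) x
    simp [this]
  rcases eq_or_ne b 0 with hb0 | hb0
  · have : g = 0 := by ext x; simpa using (ENNReal.iSup_eq_zero.1 hb0) x
    simp [this]
  -- The geometric mean is the scaling of h for which f/a, g/b, h/c still satisfy the hypothesis.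
  set c : ℝ≥0∞ := (a * b) ^ (2⁻¹ : ℝ) with hc
  have hc2 : c ^ 2 = a * b := by
    rw [hc, ← ENNReal.rpow_natCast, ← ENNReal.rpow_mul]
    norm_num
  have hc0 : c ≠ 0 := by
    rintro h0
    rw [h0] at hc2
    simp [ha0, hb0] at hc2
  have hct : c ≠ ∞ := by
    rintro h0
    rw [h0] at hc2
    simp [eq_comm, ENNReal.mul_eq_top, hfs, hgs] at hc2
  have key := lintegral_mul_lintegral_le_of_iSup_eq_one (hf.const_mul a⁻¹) (hg.const_mul b⁻¹)
    (hh.const_mul c⁻¹) (by rw [← ENNReal.mul_iSup, ← ha, ENNReal.inv_mul_cancel ha0 hfs])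
    (by rw [← ENNReal.mul_iSup, ← hb, ENNReal.inv_mul_cancel hb0 hgs]) ?_
  · rw [lintegral_const_mul _ hf, lintegral_const_mul _ hg, lintegral_const_mul _ hh, mul_pow,
      ← ENNReal.inv_pow, hc2, mul_mul_mul_comm, ← ENNReal.mul_inv (.inl ha0) (.inl hfs)] at key
    refine (ENNReal.mul_le_mul_iff_right ?_ ?_).1 key
    · simp [ENNReal.mul_eq_top, hfs, hgs]
    · simp [ha0, hb0]
  · intro x y
    rw [mul_pow, ← ENNReal.inv_pow, hc2, mul_mul_mul_comm, ← ENNReal.mul_inv (.inl ha0) (.inl hfs)]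
    exact mul_le_mul_right (H x y) _

/-- The one-dimensional Prékopa–Leindler inequality. -/
theorem isMidpointLogConcave_volume_real : IsMidpointLogConcave (volume : Measure ℝ) := by
  intro f g h hf hg hh H
  have lim : ∀ {u : ℝ → ℝ≥0∞}, Measurable u →
      ∫⁻ x, u x = ⨆ n : ℕ, ∫⁻ x, min (u x) n := by
    intro u hu
    rw [← lintegral_iSup (fun n => hu.min measurable_const)]
    · congr with x
      rw [← inf_iSup_eq, ENNReal.iSup_natCast, inf_top_eq]
    · intro m n hmn x
      exact min_le_min_left _ (by exact_mod_cast hmn)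
  rw [lim hf, lim hg, ENNReal.iSup_mul]
  simp_rw [ENNReal.mul_iSup]
  refine iSup_le fun m => iSup_le fun n => ?_
  refine lintegral_mul_lintegral_le_of_iSup_ne_top (hf.min measurable_const)
    (hg.min measurable_const) hh ?_ ?_ fun x y =>
      (mul_le_mul' (min_le_left _ _) (min_le_left _ _)).trans (H x y)
  · exact ((iSup_le fun x => min_le_right _ _).trans_lt (ENNReal.natCast_lt_top m)).ne
  · exact ((iSup_le fun x => min_le_right _ _).trans_lt (ENNReal.natCast_lt_top n)).ne

/-! ### Stability of midpoint log-concavity. -/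

namespace IsMidpointLogConcave

variable {E F : Type*} [AddCommGroup E] [Module ℝ E] [MeasurableSpace E]
  [AddCommGroup F] [Module ℝ F] [MeasurableSpace F] {μ : Measure E} {ν : Measure F}

/-- Tensorization: the inequality for ν on fibres says that the fibre integrals satisfy the
hypothesis of the inequality for μ. -/
theorem prod [SFinite ν] (hμ : IsMidpointLogConcave μ) (hν : IsMidpointLogConcave ν) :
    IsMidpointLogConcave (μ.prod ν) := by
  intro f g h hf hg hh H
  rw [lintegral_prod _ hf.aemeasurable, lintegral_prod _ hg.aemeasurable,
    lintegral_prod _ hh.aemeasurable]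
  refine hμ _ _ _ hf.lintegral_prod_right' hg.lintegral_prod_right' hh.lintegral_prod_right'
    fun x x' => ?_
  exact hν _ _ _ (hf.comp measurable_prodMk_left) (hg.comp measurable_prodMk_left)
    (hh.comp measurable_prodMk_left) fun y y' => H (x, y) (x', y')

theorem map (hμ : IsMidpointLogConcave μ) (T : E →ₗ[ℝ] F) (hT : Measurable T) :
    IsMidpointLogConcave (μ.map T) := by
  intro f g h hf hg hh H
  rw [lintegral_map hf hT, lintegral_map hg hT, lintegral_map hh hT]
  exact hμ _ _ _ (hf.comp hT) (hg.comp hT) (hh.comp hT) fun x y => by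
    simpa using H (T x) (T y)

theorem conv [MeasurableAdd₂ E] {ν : Measure E} [SFinite ν] (hμ : IsMidpointLogConcave μ)
    (hν : IsMidpointLogConcave ν) : IsMidpointLogConcave (μ.conv ν) :=
  (hμ.prod hν).map (LinearMap.fst ℝ E E + LinearMap.snd ℝ E E) measurable_add

theorem smul (hμ : IsMidpointLogConcave μ) (c : ℝ≥0∞) : IsMidpointLogConcave (c • μ) := by
  intro f g h hf hg hh H
  simp only [lintegral_smul_measure, smul_eq_mul]
  rw [mul_mul_mul_comm, mul_pow, ← sq]
  exact mul_le_mul_right (hμ f g h hf hg hh H) _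

/-- Multiply the three functions by the indicator of K: by convexity the midpoint lies in K whenever
the left side does not vanish. -/
theorem restrict (hμ : IsMidpointLogConcave μ) {K : Set E} (hK : Convex ℝ K)
    (hKm : MeasurableSet K) : IsMidpointLogConcave (μ.restrict K) := by
  intro f g h hf hg hh H
  simp only [← lintegral_indicator hKm]
  refine hμ _ _ _ (hf.indicator hKm) (hg.indicator hKm) (hh.indicator hKm) fun x y => ?_
  by_cases hx : x ∈ K
  · by_cases hy : y ∈ K
    · have : (2⁻¹ : ℝ) • (x + y) ∈ K := by
        rw [smul_add]
        exact hK hx hy (by norm_num) (by norm_num) (by norm_num)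
      simp only [Set.indicator_of_mem, hx, hy, this]
      exact H x y
    · simp [hy]
  · simp [hx]

theorem cond (hμ : IsMidpointLogConcave μ) {K : Set E} (hK : Convex ℝ K)
    (hKm : MeasurableSet K) : IsMidpointLogConcave (ProbabilityTheory.cond μ K) :=
  (hμ.restrict hK hKm).smul _

theorem dirac [MeasurableSingletonClass E] : IsMidpointLogConcave (Measure.dirac (0 : E)) := by
  intro f g h hf hg hh H
  simpa using H 0 0

end IsMidpointLogConcave

/-! ### Prékopa–Leindler in dimension n. -/

theorem isMidpointLogConcave_volume_pi (n : ℕ) :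
    IsMidpointLogConcave (volume : Measure (Fin n → ℝ)) := by
  induction n with
  | zero =>
    rw [volume_pi, Measure.pi_of_empty (x := 0)]
    exact .dirac
  | succ n ih =>
    have e := (volume_preserving_piFinSuccAbove (fun _ : Fin (n + 1) => ℝ) 0).symm
    rw [← e.map_eq]
    have he : ⇑(MeasurableEquiv.piFinSuccAbove (fun _ : Fin (n + 1) => ℝ) 0).symm =
        ⇑(Fin.consLinearEquiv ℝ (fun _ : Fin (n + 1) => ℝ)).toLinearMap := by
      ext x i
      simp [MeasurableEquiv.piFinSuccAbove, Fin.consLinearEquiv, Fin.insertNthEquiv]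
    rw [he]
    exact (isMidpointLogConcave_volume_real.prod ih).map _ (he ▸ e.measurable)

/-- The Prékopa–Leindler inequality for Lebesgue measure. -/
theorem isMidpointLogConcave_volume (n : ℕ) :
    IsMidpointLogConcave (volume : Measure (EuclideanSpace ℝ (Fin n))) := by
  have e := PiLp.volume_preserving_toLp (Fin n)
  rw [← e.map_eq]
  exact (isMidpointLogConcave_volume_pi n).map
    (WithLp.linearEquiv 2 ℝ (Fin n → ℝ)).symm.toLinearMap e.measurable

/-! ### Symmetric log-concave probability measures. -/

/-- A probability measure that is midpoint log-concave and invariant under `x ↦ -x`. -/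
structure IsSymmetricLogConcave {E : Type*} [AddCommGroup E] [Module ℝ E] [MeasurableSpace E]
    (μ : Measure E) : Prop where
  isProbabilityMeasure : IsProbabilityMeasure μ
  isMidpointLogConcave : IsMidpointLogConcave μ
  map_neg : μ.map Neg.neg = μ

namespace IsSymmetricLogConcave

variable {E F : Type*} [AddCommGroup E] [Module ℝ E] [MeasurableSpace E]
  [AddCommGroup F] [Module ℝ F] [MeasurableSpace F] {μ ν : Measure E}

theorem map [MeasurableNeg E] [MeasurableNeg F] (hμ : IsSymmetricLogConcave μ) (T : E →ₗ[ℝ] F)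
    (hT : Measurable T) : IsSymmetricLogConcave (μ.map T) where
  isProbabilityMeasure :=
    have := hμ.isProbabilityMeasure
    Measure.isProbabilityMeasure_map hT.aemeasurable
  isMidpointLogConcave := hμ.isMidpointLogConcave.map T hT
  map_neg := by
    rw [Measure.map_map measurable_neg hT]
    conv_rhs => rw [← hμ.map_neg, Measure.map_map hT measurable_neg]
    congr 1
    ext x
    simp

theorem conv [MeasurableAdd₂ E] [MeasurableNeg E] (hμ : IsSymmetricLogConcave μ)
    (hν : IsSymmetricLogConcave ν) : IsSymmetricLogConcave (μ.conv ν) where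
  isProbabilityMeasure :=
    have := hμ.isProbabilityMeasure
    have := hν.isProbabilityMeasure
    inferInstance
  isMidpointLogConcave :=
    have := hν.isProbabilityMeasure
    hμ.isMidpointLogConcave.conv hν.isMidpointLogConcave
  map_neg := by
    have := hμ.isProbabilityMeasure
    have := hν.isProbabilityMeasure
    have h := Measure.map_conv_addMonoidHom (μ := μ) (ν := ν) (negAddMonoidHom (α := E))
      measurable_neg
    rw [coe_negAddMonoidHom] at h
    exact h.trans (by rw [hμ.map_neg, hν.map_neg])

theorem dirac [MeasurableSingletonClass E] [MeasurableNeg E] :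
    IsSymmetricLogConcave (Measure.dirac (0 : E)) where
  isProbabilityMeasure := inferInstance
  isMidpointLogConcave := .dirac
  map_neg := by rw [Measure.map_dirac' measurable_neg, neg_zero]

end IsSymmetricLogConcave

theorem isSymmetricLogConcave_of_mem_symmetricBodyUniforms {n : ℕ}
    {ν : FiniteMeasure (EuclideanSpace ℝ (Fin n))} (hν : ν ∈ symmetricBodyUniforms n) :
    IsSymmetricLogConcave (ν : Measure (EuclideanSpace ℝ (Fin n))) := by
  obtain ⟨K, hK, hKc, hKi, hKs, hν⟩ := hν
  have hK0 : volume K ≠ 0 := (Measure.measure_pos_of_nonempty_interior _ hKi).ne'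
  rw [hν]
  refine ⟨cond_isProbabilityMeasure_of_finite hK0 hK.measure_lt_top.ne,
    (isMidpointLogConcave_volume n).cond hKc hK.measurableSet, ?_⟩
  ext s hs
  have hpre : Neg.neg ⁻¹' (K ∩ s) = K ∩ Neg.neg ⁻¹' s := by
    ext x
    refine and_congr_left fun _ => ⟨fun h => ?_, hKs x⟩
    simpa using hKs _ h
  rw [Measure.map_apply measurable_neg hs, cond_apply hK.measurableSet,
    cond_apply hK.measurableSet, ← hpre, Measure.measure_preimage_neg]

/-! ### Weak limits of mixtures, by duality. -/

section Mixture

variable {E F : Type*} [NormedAddCommGroup E] [NormedSpace ℝ E] [MeasurableSpace E] [BorelSpace E]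
  [NormedAddCommGroup F] [NormedSpace ℝ F] [MeasurableSpace F] [BorelSpace F]

/-- A measure lies in the weakly closed convex hull of the symmetric log-concave probability
measures, expressed by duality with bounded continuous functions. -/
def IsLogConcaveMixture (μ : Measure E) : Prop :=
  ∀ f : E →ᵇ ℝ, (∀ ν : Measure E, IsSymmetricLogConcave ν → ∫ x, f x ∂ν ≤ 0) → ∫ x, f x ∂μ ≤ 0

omit [BorelSpace E] in
theorem IsSymmetricLogConcave.isLogConcaveMixture {μ : Measure E} (hμ : IsSymmetricLogConcave μ) :
    IsLogConcaveMixture μ :=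
  fun _ hf => hf μ hμ

/-- The bounded continuous function `x ↦ ∫ f (x + y) ∂μ(y)`. -/
noncomputable def BoundedContinuousFunction.averageTranslates [SecondCountableTopology E]
    (f : E →ᵇ ℝ) (μ : Measure E) [IsProbabilityMeasure μ] : E →ᵇ ℝ :=
  .ofNormedAddCommGroup (fun x => ∫ y, f (x + y) ∂μ)
    (continuous_of_dominated (bound := fun _ => ‖f‖)
      (fun x => (f.continuous.comp (continuous_const_add x)).aestronglyMeasurable)
      (fun x => ae_of_all _ fun y => f.norm_coe_le_norm _) (integrable_const _)
      (ae_of_all _ fun y => f.continuous.comp (continuous_add_const y))) ‖f‖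
    (fun x => (norm_integral_le_of_norm_le_const
      (ae_of_all _ fun y => f.norm_coe_le_norm _)).trans (by simp))

omit [NormedSpace ℝ E] in
theorem BoundedContinuousFunction.integral_averageTranslates [SecondCountableTopology E]
    (f : E →ᵇ ℝ) (μ ν : Measure E) [IsProbabilityMeasure μ] [IsProbabilityMeasure ν] :
    ∫ x, f.averageTranslates ν x ∂μ = ∫ x, f x ∂(μ.conv ν) :=
  (integral_conv (f.integrable _)).symm

namespace IsLogConcaveMixture

theorem map {μ : Measure E} (hμ : IsLogConcaveMixture μ) (T : E →L[ℝ] F) :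
    IsLogConcaveMixture (μ.map T) := by
  intro f hf
  have hint : ∀ ν : Measure E, ∫ x, f x ∂(ν.map T) = ∫ x, f (T x) ∂ν := fun ν =>
    integral_map T.continuous.aemeasurable f.continuous.aestronglyMeasurable
  rw [hint]
  refine hμ (f.compContinuous ⟨T, T.continuous⟩) fun ν hν => ?_
  exact (hint ν).symm.trans_le (hf _ (hν.map T.toLinearMap T.continuous.measurable))

/-- The integral of f against a convolution is linear in each factor, and averaging translates of f
leaves it bounded and continuous. Hence the factors can be replaced by symmetric log-concave
measures one at a time. -/
theorem conv [SecondCountableTopology E] {μ ν : Measure E} [IsProbabilityMeasure μ]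
    [IsProbabilityMeasure ν] (hμ : IsLogConcaveMixture μ) (hν : IsLogConcaveMixture ν) :
    IsLogConcaveMixture (μ.conv ν) := by
  intro f hf
  rw [← f.integral_averageTranslates]
  refine hμ _ fun μ' hμ' => ?_
  have := hμ'.isProbabilityMeasure
  rw [f.integral_averageTranslates, Measure.conv_comm, ← f.integral_averageTranslates]
  refine hν _ fun ν' hν' => ?_
  have := hν'.isProbabilityMeasure
  rw [f.integral_averageTranslates]
  exact hf _ (hν'.conv hμ')

end IsLogConcaveMixture

end Mixture

/-- For a fixed test function the condition ∫ f ≤ 0 is convex and weakly closed in the measure, so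
it passes from the uniform laws to their closed convex hull. -/
theorem IsCentralConvexUnimodal.isLogConcaveMixture {n : ℕ}
    {D : ProbabilityMeasure (EuclideanSpace ℝ (Fin n))} (hD : IsCentralConvexUnimodal D) :
    IsLogConcaveMixture (D : Measure (EuclideanSpace ℝ (Fin n))) := by
  intro f hf
  have hclosed : IsClosed {μ : ProbabilityMeasure (EuclideanSpace ℝ (Fin n)) |
      ∫ x, f x ∂(μ : Measure (EuclideanSpace ℝ (Fin n))) ≤ 0} :=
    isClosed_le (ProbabilityMeasure.continuous_integral_boundedContinuousFunction f)
      continuous_const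
  refine closure_minimal (fun μ hμ => ?_) hclosed hD
  have hconv : Convex ℝ≥0 {μ : FiniteMeasure (EuclideanSpace ℝ (Fin n)) |
      ∫ x, f x ∂(μ : Measure (EuclideanSpace ℝ (Fin n))) ≤ 0} := by
    intro μ hμ ν hν a b _ _ _
    simp only [Set.mem_ofPred_eq, FiniteMeasure.toMeasure_add, FiniteMeasure.toMeasure_smul] at *
    rw [integral_add_measure (f.integrable _) (f.integrable _), integral_smul_nnreal_measure,
      integral_smul_nnreal_measure]
    exact add_nonpos (smul_nonpos_of_nonneg_of_nonpos a.2 hμ)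
      (smul_nonpos_of_nonneg_of_nonpos b.2 hν)
  exact convexHull_min
    (fun ν hν => hf _ (isSymmetricLogConcave_of_mem_symmetricBodyUniforms hν)) hconv hμ

/-! ### Convex hulls of compact sets. -/

/-- In finite dimension, the convex hull of a compact set is compact. -/
theorem IsCompact.isCompact_convexHull_of_finiteDimensional {E : Type*} [NormedAddCommGroup E]
    [NormedSpace ℝ E] [FiniteDimensional ℝ E] {s : Set E} (hs : IsCompact s) :
    IsCompact (convexHull ℝ s) := by
  classical
  -- `C m` consists of the convex combinations of m + 1 points of s, so by Carathéodory it exhausts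
  -- the hull for large m. Indexing by the cardinality of a finite set in `hfin` allows one join
  -- more than needed.
  let C : ℕ → Set E := fun m => Nat.rec (motive := fun _ => Set E) s (fun _ c =>
    (fun q : ℝ × E × E => (1 - q.1) • q.2.1 + q.1 • q.2.2) '' (Set.Icc 0 1 ×ˢ s ×ˢ c)) m
  have hC : ∀ m, C (m + 1) =
      (fun q : ℝ × E × E => (1 - q.1) • q.2.1 + q.1 • q.2.2) '' (Set.Icc 0 1 ×ˢ s ×ˢ C m) :=
    fun m => rfl
  have hcompact : ∀ m, IsCompact (C m) := by
    intro m
    induction m with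
    | zero => exact hs
    | succ m ih =>
      rw [hC]
      exact (isCompact_Icc.prod (hs.prod ih)).image (by fun_prop)
  have hsub : ∀ m, C m ⊆ convexHull ℝ s := by
    intro m
    induction m with
    | zero => exact subset_convexHull ℝ s
    | succ m ih =>
      rw [hC]
      rintro _ ⟨⟨t, x, y⟩, ⟨ht, hx, hy⟩, rfl⟩
      exact convex_convexHull ℝ s (subset_convexHull ℝ s hx) (ih hy) (sub_nonneg.2 ht.2) ht.1
        (by simp)
  have hmono : Monotone C := by
    refine monotone_nat_of_le_succ fun m => ?_
    rw [hC]
    intro y hy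
    obtain ⟨x, hx⟩ : s.Nonempty := convexHull_nonempty_iff.1 ⟨y, hsub m hy⟩
    exact ⟨(1, x, y), ⟨by simp, hx, hy⟩, by simp⟩
  have hfin : ∀ t : Finset E, (t : Set E) ⊆ s → convexHull ℝ (t : Set E) ⊆ C t.card := by
    intro t
    induction t using Finset.induction_on with
    | empty => simp
    | insert a t ha ih =>
      intro hts
      rw [Finset.coe_insert, Set.insert_subset_iff] at hts
      rw [Finset.card_insert_of_notMem ha, Finset.coe_insert]
      rcases t.eq_empty_or_nonempty with rfl | ht
      · simpa using hmono (Nat.zero_le 1) hts.1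
      · rw [convexHull_insert ht, convexJoin_singleton_left]
        refine Set.iUnion₂_subset fun y hy => ?_
        rw [segment_eq_image, hC]
        rintro _ ⟨θ, hθ, rfl⟩
        exact ⟨(θ, a, y), ⟨hθ, hts.1, ih hts.2 hy⟩, rfl⟩
  have : convexHull ℝ s = C (Module.finrank ℝ E + 1) := by
    refine Set.Subset.antisymm ?_ (hsub (Module.finrank ℝ E + 1))
    rw [convexHull_eq_union]
    refine Set.iUnion_subset fun t => Set.iUnion₂_subset fun hts hai => ?_
    have h := hai.card_le_finrank_succ
    rw [Fintype.card_coe] at h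
    have hcard : t.card ≤ Module.finrank ℝ E + 1 :=
      h.trans (Nat.add_le_add_right (Submodule.finrank_le _) 1)
    exact (hfin t hts).trans (hmono hcard)
  exact this ▸ hcompact (Module.finrank ℝ E + 1)

/-! ### Anderson's inequality. -/

section Anderson

variable {E : Type*} [NormedAddCommGroup E]

theorem IsSymmetricSet.infDist_neg {R : Set E} (hR : IsSymmetricSet R) (x : E) :
    Metric.infDist (-x) R = Metric.infDist x R := by
  have h : Neg.neg '' R = R := by
    ext y
    refine ⟨?_, fun hy => ⟨-y, hR y hy, neg_neg y⟩⟩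
    rintro ⟨z, hz, rfl⟩
    exact hR z hz
  conv_lhs => rw [← h]
  exact Metric.infDist_image isometry_neg

/-- The bounded continuous approximation `x ↦ exp (-k d(x, R))` of the indicator function
of `R`. -/
noncomputable def expNegInfDist (R : Set E) (k : ℕ) : E →ᵇ ℝ :=
  .ofNormedAddCommGroup (fun x => Real.exp (-(k * Metric.infDist x R)))
    (by fun_prop) 1 (fun x => by
      rw [Real.norm_of_nonneg (Real.exp_nonneg _), Real.exp_le_one_iff, neg_nonpos]
      exact mul_nonneg k.cast_nonneg Metric.infDist_nonneg)

theorem expNegInfDist_apply (R : Set E) (k : ℕ) (x : E) :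
    expNegInfDist R k x = Real.exp (-(k * Metric.infDist x R)) := rfl

variable [NormedSpace ℝ E]

/-- The midpoint of nearest points lies in R. This makes exp(-k d(·, R)) log-concave. -/
theorem Convex.infDist_midpoint_le [ProperSpace E] {R : Set E} (hR : Convex ℝ R)
    (hRc : IsClosed R) (hR0 : R.Nonempty) (x y : E) :
    2 * Metric.infDist ((2⁻¹ : ℝ) • (x + y)) R ≤ Metric.infDist x R + Metric.infDist y R := by
  obtain ⟨r, hr, hxr⟩ := hRc.exists_infDist_eq_dist hR0 x
  obtain ⟨s, hs, hys⟩ := hRc.exists_infDist_eq_dist hR0 y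
  have hmem : (2⁻¹ : ℝ) • (r + s) ∈ R := by
    rw [smul_add]
    exact hR hr hs (by norm_num) (by norm_num) (by norm_num)
  have h1 := Metric.infDist_le_dist_of_mem (x := (2⁻¹ : ℝ) • (x + y)) hmem
  rw [dist_smul₀, Real.norm_of_nonneg (by norm_num)] at h1
  have h2 := dist_add_add_le x y r s
  rw [hxr, hys]
  linarith

variable [MeasurableSpace E] [BorelSpace E]

/-- Prékopa–Leindler for φ(· + z), φ(· - z) and φ: the shifts cancel at the midpoint, and the first
two integrals agree because ν and R are symmetric. -/
theorem integral_expNegInfDist_add_le [ProperSpace E] {ν : Measure E}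
    (hν : IsSymmetricLogConcave ν) {R : Set E} (hR : Convex ℝ R) (hRc : IsClosed R)
    (hR0 : R.Nonempty) (hRs : IsSymmetricSet R) (k : ℕ) (z : E) :
    ∫ x, expNegInfDist R k (x + z) ∂ν ≤ ∫ x, expNegInfDist R k x ∂ν := by
  have := hν.isProbabilityMeasure
  set φ := expNegInfDist R k with hφ
  have hφ0 : ∀ x, 0 ≤ φ x := fun x => Real.exp_nonneg _
  have hm : Measurable fun x => ENNReal.ofReal (φ x) :=
    φ.continuous.measurable.ennreal_ofReal
  have key := hν.isMidpointLogConcave (fun x => ENNReal.ofReal (φ (x + z)))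
    (fun x => ENNReal.ofReal (φ (x - z))) (fun x => ENNReal.ofReal (φ x))
    (hm.comp (measurable_add_const z)) (hm.comp (measurable_sub_const z)) hm ?_
  · have hsymm : ∫⁻ x, ENNReal.ofReal (φ (x - z)) ∂ν = ∫⁻ x, ENNReal.ofReal (φ (x + z)) ∂ν := by
      conv_lhs => rw [← hν.map_neg]
      rw [lintegral_map (f := fun x => ENNReal.ofReal (φ (x - z)))
        (hm.comp (measurable_sub_const z)) measurable_neg]
      refine lintegral_congr fun x => ?_
      rw [show -x - z = -(x + z) by abel, hφ, expNegInfDist_apply, expNegInfDist_apply,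
        hRs.infDist_neg]
    rw [hsymm, ← sq, ENNReal.pow_le_pow_left_iff two_ne_zero] at key
    rw [integral_eq_lintegral_of_nonneg_ae (ae_of_all _ fun x => hφ0 _)
        (φ.continuous.comp (continuous_add_const z)).aestronglyMeasurable,
      integral_eq_lintegral_of_nonneg_ae (ae_of_all _ hφ0) φ.continuous.aestronglyMeasurable]
    refine ENNReal.toReal_mono ?_ key
    exact (φ.integrable ν).lintegral_lt_top.ne
  · intro x y
    rw [← ENNReal.ofReal_mul (hφ0 _), ← ENNReal.ofReal_pow (hφ0 _)]
    refine ENNReal.ofReal_le_ofReal ?_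
    simp only [hφ, expNegInfDist_apply]
    rw [← Real.exp_add, ← Real.exp_nat_mul, Real.exp_le_exp]
    have h := hR.infDist_midpoint_le hRc hR0 (x + z) (y - z)
    rw [add_add_sub_cancel] at h
    have := mul_le_mul_of_nonneg_left h (Nat.cast_nonneg (α := ℝ) k)
    push_cast
    linarith

namespace IsLogConcaveMixture

variable {μ : Measure E} [IsProbabilityMeasure μ]

/-- The difference φ(· + z) - φ is an admissible test function in the dual definition; as k → ∞ the
integral of φ tends to the measure of R, which is closed. -/
theorem measureReal_preimage_add_le_of_isClosed [ProperSpace E] (hμ : IsLogConcaveMixture μ)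
    {R : Set E} (hR : Convex ℝ R) (hRc : IsClosed R) (hRs : IsSymmetricSet R) (z : E) :
    μ.real ((· + z) ⁻¹' R) ≤ μ.real R := by
  rcases R.eq_empty_or_nonempty with rfl | hR0
  · simp
  have hle : ∀ k, μ.real ((· + z) ⁻¹' R) ≤ ∫ x, expNegInfDist R k x ∂μ := by
    intro k
    set φ := expNegInfDist R k with hφ
    let ψ : E →ᵇ ℝ := φ.compContinuous ⟨(· + z), continuous_add_const z⟩
    have h := hμ (ψ - φ) fun ν hν => by
      have := hν.isProbabilityMeasure
      have h := integral_expNegInfDist_add_le hν hR hRc hR0 hRs k z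
      have h2 := integral_sub (ψ.integrable ν) (φ.integrable ν)
      exact h2.trans_le (sub_nonpos.2 h)
    have h2 : ∫ x, ψ x ∂μ ≤ ∫ x, φ x ∂μ :=
      sub_nonpos.1 ((integral_sub (ψ.integrable μ) (φ.integrable μ)).symm.trans_le h)
    refine le_trans ?_ h2
    have hms : MeasurableSet ((· + z) ⁻¹' R) := (measurable_add_const z) hRc.measurableSet
    rw [← integral_indicator_one hms]
    refine integral_mono ((integrable_const (1 : ℝ)).indicator hms) (ψ.integrable μ) fun x => ?_
    by_cases hx : x + z ∈ R
    · simp [ψ, hφ, hx, expNegInfDist_apply, Metric.infDist_zero_of_mem hx]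
    · rw [Set.indicator_of_notMem (by exact hx)]
      exact Real.exp_nonneg _
  have hlim : Tendsto (fun k => ∫ x, expNegInfDist R k x ∂μ) atTop (𝓝 (μ.real R)) := by
    rw [← integral_indicator_one hRc.measurableSet]
    refine tendsto_integral_of_dominated_convergence (fun _ => 1)
      (fun k => (expNegInfDist R k).continuous.aestronglyMeasurable) (integrable_const _)
      (fun k => ae_of_all _ fun x => ?_) (ae_of_all _ fun x => ?_)
    · rw [expNegInfDist_apply, Real.norm_of_nonneg (Real.exp_nonneg _), Real.exp_le_one_iff,
        neg_nonpos]
      exact mul_nonneg k.cast_nonneg Metric.infDist_nonneg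
    · simp only [expNegInfDist_apply]
      by_cases hx : x ∈ R
      · simp [hx, Metric.infDist_zero_of_mem hx]
      · have hpos := (hRc.notMem_iff_infDist_pos hR0).1 hx
        simp only [hx, not_false_eq_true, Set.indicator_of_notMem]
        exact Real.tendsto_exp_neg_atTop_nhds_zero.comp
          (tendsto_natCast_atTop_atTop.atTop_mul_const hpos)
  exact ge_of_tendsto' hlim hle

/-- Anderson's inequality: translating a symmetric convex set does not increase its measure. -/
theorem measureReal_preimage_add_le [FiniteDimensional ℝ E] (hμ : IsLogConcaveMixture μ)
    {R : Set E} (hRm : MeasurableSet R) (hR : Convex ℝ R) (hRs : IsSymmetricSet R) (z : E) :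
    μ.real ((· + z) ⁻¹' R) ≤ μ.real R := by
  have := FiniteDimensional.proper ℝ E
  refine ENNReal.toReal_mono (measure_ne_top _ _) ?_
  rw [((measurable_add_const z) hRm).measure_eq_iSup_isCompact]
  refine iSup₂_le fun K hK => iSup_le fun hKc => ?_
  have hL : IsCompact ((· + z) '' K) := hKc.image (continuous_add_const z)
  set L := (· + z) '' K with hLdef
  have hLR : L ⊆ R := Set.image_subset_iff.2 hK
  -- R need not be closed. The hull of ±(K + z) is a compact symmetric convex subset of R whose
  -- translate contains K, so the closed case suffices.
  set C := convexHull ℝ (L ∪ Neg.neg '' L) with hC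
  have hCc : IsCompact C :=
    (hL.union (hL.image continuous_neg)).isCompact_convexHull_of_finiteDimensional
  have hCs : IsSymmetricSet C := by
    intro x hx
    have hsub : C ⊆ (-LinearMap.id : E →ₗ[ℝ] E) ⁻¹' C := by
      refine convexHull_min ?_ ((convex_convexHull ℝ _).linear_preimage _)
      rintro y (hy | ⟨y, hy, rfl⟩)
      · exact subset_convexHull ℝ _ (.inr ⟨y, hy, rfl⟩)
      · refine subset_convexHull ℝ _ (.inl ?_)
        simpa using hy
    exact hsub hx
  have hCR : C ⊆ R := by
    refine convexHull_min (Set.union_subset hLR ?_) hR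
    rintro _ ⟨y, hy, rfl⟩
    exact hRs y (hLR hy)
  have h := hμ.measureReal_preimage_add_le_of_isClosed (convex_convexHull ℝ _) hCc.isClosed hCs z
  refine le_trans (measure_mono fun x hx => ?_)
    (((ENNReal.toReal_le_toReal (measure_ne_top _ _) (measure_ne_top _ _)).1 h).trans
      (measure_mono hCR))
  exact subset_convexHull ℝ _ (.inl ⟨x, hx, rfl⟩)

/-- The left side is the ν-average of the measures of translates of R. -/
theorem measureReal_conv_le [FiniteDimensional ℝ E] (hμ : IsLogConcaveMixture μ) (ν : Measure E)
    [IsProbabilityMeasure ν] {R : Set E} (hRm : MeasurableSet R) (hR : Convex ℝ R)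
    (hRs : IsSymmetricSet R) : (μ.conv ν).real R ≤ μ.real R := by
  have := FiniteDimensional.proper ℝ E
  refine ENNReal.toReal_mono (measure_ne_top _ _) ?_
  rw [Measure.conv_comm, ← lintegral_indicator_one hRm,
    Measure.lintegral_conv (measurable_one.indicator hRm)]
  calc ∫⁻ z, ∫⁻ x, R.indicator 1 (z + x) ∂μ ∂ν ≤ ∫⁻ _, μ R ∂ν := by
        refine lintegral_mono fun z => ?_
        have hz : ∫⁻ x, R.indicator 1 (z + x) ∂μ = μ ((· + z) ⁻¹' R) := by
          rw [← lintegral_indicator_one ((measurable_add_const z) hRm)]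
          refine lintegral_congr fun x => ?_
          rw [add_comm z x]
          rfl
        rw [hz]
        exact (ENNReal.toReal_le_toReal (measure_ne_top _ _) (measure_ne_top _ _)).1
          (hμ.measureReal_preimage_add_le hRm hR hRs z)
    _ = μ R := by simp

end IsLogConcaveMixture

end Anderson

/-! ### The law of the state. -/

/-- The law of the state `x(k)` started at `x(0) = 0`, for disturbances of law `D`. -/
noncomputable def stateLaw {n : ℕ} (A : Matrix (Fin n) (Fin n) ℝ)
    (D : Measure (EuclideanSpace ℝ (Fin n))) : ℕ → Measure (EuclideanSpace ℝ (Fin n))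
  | 0 => Measure.dirac 0
  | k + 1 => ((stateLaw A D k).map (Matrix.toEuclideanLin A).toContinuousLinearMap).conv D

section StateLaw

variable {n : ℕ} (A : Matrix (Fin n) (Fin n) ℝ) (D : Measure (EuclideanSpace ℝ (Fin n)))
  [IsProbabilityMeasure D]

instance isProbabilityMeasure_stateLaw (k : ℕ) : IsProbabilityMeasure (stateLaw A D k) := by
  induction k with
  | zero => exact inferInstanceAs (IsProbabilityMeasure (Measure.dirac _))
  | succ k ih =>
    have := Measure.isProbabilityMeasure_map (μ := stateLaw A D k)
      (Matrix.toEuclideanLin A).toContinuousLinearMap.continuous.aemeasurable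
    exact inferInstanceAs (IsProbabilityMeasure (Measure.conv _ _))

variable {D} in
theorem IsLogConcaveMixture.stateLaw (hD : IsLogConcaveMixture D) (k : ℕ) :
    IsLogConcaveMixture (stateLaw A D k) := by
  induction k with
  | zero => exact IsSymmetricLogConcave.dirac.isLogConcaveMixture
  | succ k ih =>
    have := Measure.isProbabilityMeasure_map (μ := _root_.stateLaw A D k)
      (Matrix.toEuclideanLin A).toContinuousLinearMap.continuous.aemeasurable
    exact (ih.map _).conv hD

/-- By time reversal, `x(k+1)` has the law of `x(k)` plus an independent vector. -/
theorem exists_stateLaw_succ_eq_conv (k : ℕ) :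
    ∃ ν : Measure (EuclideanSpace ℝ (Fin n)), IsProbabilityMeasure ν ∧
      stateLaw A D (k + 1) = (stateLaw A D k).conv ν := by
  set T := (Matrix.toEuclideanLin A).toContinuousLinearMap with hT
  have hTm : ∀ μ : Measure (EuclideanSpace ℝ (Fin n)), IsProbabilityMeasure μ →
      IsProbabilityMeasure (μ.map T) := fun μ _ =>
    Measure.isProbabilityMeasure_map T.continuous.aemeasurable
  induction k with
  | zero =>
    refine ⟨D, inferInstance, ?_⟩
    simp only [stateLaw]
    rw [Measure.map_dirac' T.continuous.measurable, map_zero]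
  | succ k ih =>
    obtain ⟨ν, hν, h⟩ := ih
    have := hTm _ hν
    have := hTm (stateLaw A D k) inferInstance
    -- The added vector at time k has the law of A^k w, so one more power of A appears at each step.
    refine ⟨ν.map T, inferInstance, ?_⟩
    calc stateLaw A D (k + 1 + 1) = ((stateLaw A D (k + 1)).map T).conv D := rfl
      _ = (((stateLaw A D k).map T).conv (ν.map T)).conv D := by
        rw [h, Measure.map_conv_continuousLinearMap]
      _ = (((stateLaw A D k).map T).conv D).conv (ν.map T) := by
        rw [Measure.conv_assoc, Measure.conv_comm (ν.map T), ← Measure.conv_assoc]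

variable {D} in
theorem antitone_stateLaw_real (hD : IsLogConcaveMixture D)
    {R : Set (EuclideanSpace ℝ (Fin n))} (hRm : MeasurableSet R) (hR : Convex ℝ R)
    (hRs : IsSymmetricSet R) : Antitone fun k => (stateLaw A D k).real R := by
  refine antitone_nat_of_succ_le fun k => ?_
  obtain ⟨ν, hν, h⟩ := exists_stateLaw_succ_eq_conv A D k
  rw [h]
  exact (hD.stateLaw A k).measureReal_conv_le ν hRm hR hRs

end StateLaw

section State

variable {n : ℕ} {Ω : Type*} {A : Matrix (Fin n) (Fin n) ℝ}
  {w : ℕ → Ω → EuclideanSpace ℝ (Fin n)}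

/-- The state at time k depends only on the disturbances before k; this yields its independence of
`w k`. -/
theorem exists_measurable_stateFromZero_eq (A : Matrix (Fin n) (Fin n) ℝ)
    (w : ℕ → Ω → EuclideanSpace ℝ (Fin n)) (k : ℕ) :
    ∃ φ : (Finset.range k → EuclideanSpace ℝ (Fin n)) → EuclideanSpace ℝ (Fin n),
      Measurable φ ∧ stateFromZero A w k = fun ω => φ fun i => w i ω := by
  induction k with
  | zero => exact ⟨fun _ => 0, measurable_const, rfl⟩
  | succ k ih =>
    obtain ⟨φ, hφ, h⟩ := ih
    refine ⟨fun u => (Matrix.toEuclideanLin A).toContinuousLinearMap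
      (φ fun i => u ⟨i, Finset.range_subset_range.2 k.le_succ i.2⟩) +
        u ⟨k, Finset.self_mem_range_succ k⟩, ?_, ?_⟩
    · have hrestrict : Measurable fun (u : Finset.range (k + 1) → EuclideanSpace ℝ (Fin n))
          (i : Finset.range k) => u ⟨i, Finset.range_subset_range.2 k.le_succ i.2⟩ :=
        measurable_pi_lambda _ fun i => measurable_pi_apply _
      exact (((Matrix.toEuclideanLin A).toContinuousLinearMap.continuous.measurable.comp
        (hφ.comp hrestrict))).fun_add
          (measurable_pi_apply (⟨k, Finset.self_mem_range_succ k⟩ : Finset.range (k + 1)))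
    · ext1 ω
      simp [stateFromZero, h]

variable [MeasurableSpace Ω] {P : Measure Ω} [IsProbabilityMeasure P]
  {D : Measure (EuclideanSpace ℝ (Fin n))} [IsProbabilityMeasure D]

omit [IsProbabilityMeasure P] in
theorem indepFun_stateFromZero (hw : ∀ k, AEMeasurable (w k) P) (hindep : iIndepFun w P) (k : ℕ) :
    IndepFun (stateFromZero A w k) (w k) P := by
  obtain ⟨φ, hφ, h⟩ := exists_measurable_stateFromZero_eq A w k
  rw [h]
  exact (hindep.indepFun_finset₀ (Finset.range k) {k} (by simp) hw).comp hφ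
    (measurable_pi_apply (⟨k, Finset.mem_singleton_self k⟩ : ({k} : Finset ℕ)))

theorem hasLaw_stateFromZero (hlaw : ∀ k, HasLaw (w k) D P) (hindep : iIndepFun w P) (k : ℕ) :
    HasLaw (stateFromZero A w k) (stateLaw A D k) P := by
  induction k with
  | zero => exact hasLaw_dirac_of_ae_eq (ae_of_all _ fun _ => rfl)
  | succ k ih =>
    set T := (Matrix.toEuclideanLin A).toContinuousLinearMap with hT
    have h1 : HasLaw (T ∘ stateFromZero A w k) ((stateLaw A D k).map T) P :=
      HasLaw.comp ⟨T.continuous.aemeasurable, rfl⟩ ih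
    have := Measure.isProbabilityMeasure_map (μ := stateLaw A D k) T.continuous.aemeasurable
    exact IndepFun.hasLaw_add h1 (hlaw k) ((indepFun_stateFromZero
      (fun i => (hlaw i).aemeasurable) hindep k).comp T.continuous.measurable measurable_id)

theorem isStepPRS_iff (hlaw : ∀ k, HasLaw (w k) D P) (hindep : iIndepFun w P) (k : ℕ)
    {R : Set (EuclideanSpace ℝ (Fin n))} (hR : MeasurableSet R) (p : ℝ) :
    IsStepPRS P A w k R p ↔ p ≤ (stateLaw A D k).real R := by
  rw [IsStepPRS]
  exact iff_of_eq (congrArg (p ≤ ·)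
    ((hasLaw_stateFromZero hlaw hindep k).measureReal_eq (p := (· ∈ R)) hR))

end State

/-! ### Upper limits of sets and the conclusion. -/

theorem le_measureReal_limsup {α : Type*} [MeasurableSpace α] {μ : Measure α} [IsFiniteMeasure μ]
    {S : ℕ → Set α} {p : ℝ} (hS : ∀ᶠ n in atTop, MeasurableSet (S n))
    (hp : ∀ᶠ n in atTop, p ≤ μ.real (S n)) : p ≤ μ.real (limsup S atTop) := by
  -- Continuity from above along the tail unions, each containing a set of measure at least p. The
  -- shift by N drops the initial sets, about which nothing is known.
  obtain ⟨N, hN⟩ := eventually_atTop.1 (hS.and hp)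
  set U : ℕ → Set α := fun m => ⋃ i, S (i + m + N)
  have hlim : limsup S atTop = ⋂ m, U m := by
    rw [← limsup_nat_add S N, limsup_eq_iInf_iSup_of_nat']
    rfl
  have hU : Antitone U := by
    intro m m' h
    refine Set.iUnion_subset fun i => ?_
    obtain ⟨c, rfl⟩ := Nat.exists_eq_add_of_le h
    exact (congrArg S (by omega : i + (m + c) + N = (i + c) + m + N)).subset.trans
      (Set.subset_iUnion (fun j => S (j + m + N)) (i + c))
  have hT : Tendsto (fun m => μ.real (U m)) atTop (𝓝 (μ.real (⋂ m, U m))) :=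
    (ENNReal.tendsto_toReal (measure_ne_top _ _)).comp (tendsto_measure_iInter_atTop
      (fun m => (MeasurableSet.iUnion fun i => (hN _ (by omega)).1).nullMeasurableSet) hU
      ⟨0, measure_ne_top _ _⟩)
  rw [hlim]
  exact ge_of_tendsto' hT fun m => (hN (0 + m + N) (by omega)).2.trans
    (measureReal_mono (Set.subset_iUnion (fun j => S (j + m + N)) 0))

theorem measurableSet_limsup_of_eventually {α : Type*} [MeasurableSpace α] {S : ℕ → Set α}
    (hS : ∀ᶠ n in atTop, MeasurableSet (S n)) : MeasurableSet (limsup S atTop) := by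
  obtain ⟨N, hN⟩ := eventually_atTop.1 hS
  rw [← limsup_nat_add S N]
  exact .measurableSet_limsup fun n => hN _ (by omega)

theorem isSetLimit_iUnion_of_subset_succ {E : Type*} {S : ℕ → Set E}
    (hS : ∀ n, 1 ≤ n → S n ⊆ S (n + 1)) : IsSetLimit S (⋃ n ≥ 1, S n) := by
  -- The shift by one discards `S 0`, which is unconstrained.
  have hmono : Monotone fun n => S (n + 1) := monotone_nat_of_le_succ fun n => hS _ (by omega)
  have hU : (⋃ n ≥ 1, S n) = ⋃ n, S (n + 1) := by
    ext x
    simp only [Set.mem_iUnion, exists_prop]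
    exact ⟨fun ⟨n, hn, hx⟩ => ⟨n - 1, by rwa [Nat.sub_add_cancel hn]⟩,
      fun ⟨n, hx⟩ => ⟨n + 1, by omega, hx⟩⟩
  rw [IsSetLimit, ← liminf_nat_add S 1, ← limsup_nat_add S 1, hU]
  have hle : (⋃ n, S (n + 1)) ≤ liminf (fun n => S (n + 1)) atTop := by
    rw [liminf_eq_iSup_iInf_of_nat']
    exact Set.iUnion_subset fun n =>
      le_iSup_of_le n (le_iInf fun i => hmono (Nat.le_add_left n i))
  have hge : limsup (fun n => S (n + 1)) atTop ≤ ⋃ n, S (n + 1) := by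
    rw [limsup_eq_iInf_iSup_of_nat']
    exact iInf_le_of_le 0 (iSup_le fun i => Set.subset_iUnion (fun n => S (n + 1)) i)
  have hlele : liminf (fun n => S (n + 1)) atTop ≤ limsup (fun n => S (n + 1)) atTop :=
    liminf_le_limsup
  exact ⟨(hlele.trans hge).antisymm hle, hge.antisymm (hle.trans hlele)⟩

theorem lemma2 {nx : ℕ} {Ω : Type*} [MeasurableSpace Ω] (P : Measure Ω) [IsProbabilityMeasure P]
    (A : Matrix (Fin nx) (Fin nx) ℝ) (D : ProbabilityMeasure (EuclideanSpace ℝ (Fin nx)))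
    (w : ℕ → Ω → EuclideanSpace ℝ (Fin nx))
    (hlaw : ∀ k, HasLaw (w k) (D : Measure (EuclideanSpace ℝ (Fin nx))) P)
    (hindep : iIndepFun w P)
    (hD : IsCentralConvexUnimodal D) (p : ℝ) :
    -- an `n`-step PRS is an `(n-1)`-step PRS
    (∀ n : ℕ, 1 ≤ n → ∀ R : Set (EuclideanSpace ℝ (Fin nx)),
      MeasurableSet R → Convex ℝ R → IsSymmetricSet R →
        IsStepPRS P A w n R p → IsStepPRS P A w (n - 1) R p) ∧
    -- nestedness over all smaller horizons
    (∀ n : ℕ, ∀ R : Set (EuclideanSpace ℝ (Fin nx)),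
      MeasurableSet R → Convex ℝ R → IsSymmetricSet R →
        IsStepPRS P A w n R p → ∀ i ≤ n, IsStepPRS P A w i R p) ∧
    -- infinite-horizon PRS as a limit of `n`-step PRS
    (∀ S : ℕ → Set (EuclideanSpace ℝ (Fin nx)),
      (∀ n, 1 ≤ n → MeasurableSet (S n) ∧ Convex ℝ (S n) ∧ IsSymmetricSet (S n) ∧
        IsStepPRS P A w n (S n) p) →
      IsPRS P A w (limsup S atTop) p ∧
      (∀ L, IsSetLimit S L → IsPRS P A w L p) ∧
      ((∀ n, 1 ≤ n → S n ⊆ S (n + 1)) →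
        IsSetLimit S (⋃ n ≥ 1, S n) ∧ IsPRS P A w (⋃ n ≥ 1, S n) p)) := by
  have nested : ∀ n : ℕ, ∀ R : Set (EuclideanSpace ℝ (Fin nx)),
      MeasurableSet R → Convex ℝ R → IsSymmetricSet R →
        IsStepPRS P A w n R p → ∀ i ≤ n, IsStepPRS P A w i R p := by
    intro n R hRm hR hRs h i hi
    rw [isStepPRS_iff hlaw hindep _ hRm] at h ⊢
    exact h.trans (antitone_stateLaw_real A hD.isLogConcaveMixture hRm hR hRs hi)
  refine ⟨fun n _ R hRm hR hRs h => nested n R hRm hR hRs h _ n.pred_le, nested, fun S hS => ?_⟩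
  have hSm : ∀ᶠ n in atTop, MeasurableSet (S n) := by
    filter_upwards [eventually_ge_atTop 1] with n hn using (hS n hn).1
  have hlimsup : IsPRS P A w (limsup S atTop) p := by
    intro k
    rw [isStepPRS_iff hlaw hindep _ (measurableSet_limsup_of_eventually hSm)]
    refine le_measureReal_limsup hSm ?_
    filter_upwards [eventually_ge_atTop 1, eventually_ge_atTop k] with n hn hkn
    obtain ⟨hm, hc, hs, h⟩ := hS n hn
    exact (isStepPRS_iff hlaw hindep _ hm p).1 (nested n _ hm hc hs h k hkn)
  have hlimit : ∀ L, IsSetLimit S L → IsPRS P A w L p := fun L hL => hL.2 ▸ hlimsup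
  exact ⟨hlimsup, hlimit, fun h =>
    ⟨isSetLimit_iUnion_of_subset_succ h, hlimit _ (isSetLimit_iUnion_of_subset_succ h)⟩⟩
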